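/- \textbf{Setting.} Let $G=((V,E),(V_\exists,V_\forall,V_R),\Delta)$ be a finite stochastic arena: $(V,E)$ is a finite directed graph in which every vertex has a successor, $V=V_\exists\uplus V_\forall\uplus V_R$, and every $u\in V_R$ carries a probability distribution $\Delta(u,\cdot)$ on $V$ with $(u,v)\in E$ iff $\Delta(u,v)>0$. Let $p:V\to\mathbb N$ be a priority function and $n=|V|$. Assume that $\Delta(u,v)=a_{u,v}/b_{u,v}$ with $a_{u,v}\in\mathbb N$, $b_{u,v}\in\mathbb N_{+}$, $a_{u,v}\le b_{u,v}$ for all $u\in V_R$, $v\in V$. Put $M=\max\{b_{u,v}\mid u\in V_R,\ (u,v)\in E\}$, $\delta_{\min}=\min\{\Delta(u,v)\mid u\in V_R,\ v\in V,\ \Delta(u,v)>0\}$ and $\epsilon=\frac{1}{(n!)^2M^{2n^2}}$, and assume $0<\delta_{\min}\le\frac12$. Let $\alpha:\mathbb N\to[0,1]$ be monotonically decreasing (not necessarily strictly). The arena $\widetilde G$ has vertices $\overline v,\widehat v$ $(v\in V)$ and two absorbing sinks $v_{\mathrm{win}},v_{\mathrm{lose}}$. The vertex $\overline u$ has the owner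 of $u$; all other vertices are random. Each edge $(u,v)$ of $G$ becomes an edge $(\overline u,\widehat v)$, with probability $\Delta(u,v)$ if $u\in V_R$. From $\widehat v$ the play moves to $\overline v$ with probability $1-\alpha_{p(v)}$ and otherwise, with probability $\alpha_{p(v)}$, to $v_{\mathrm{win}}$ if $p(v)$ is even and to $v_{\mathrm{lose}}$ if $p(v)$ is odd. A pair $(\sigma,\gamma)$ of pure memoryless strategies of the two players (a choice of a successor for each vertex of $V_\exists$ and of $V_\forall$, respectively) induces Markov chains $G_{\sigma,\gamma}$ on the vertices of $G$ and $\widetilde G_{\sigma,\gamma}$ on those of $\widetilde G$ (a choice of $v$ at $u$ becomes the choice of $\widehat v$ at $\overline u$). For $U\subseteq V$ let $\widetilde U=\{\overline u,\widehat u\mid u\in U\}$. Let $\widetilde{\Pr}^{x}_{\sigma,\gamma}$ denote probabilities in $\widetilde G_{\sigma,\gamma}$ started at $x$. For $v\in V$ let $\widetilde{\Pr}^{\overline v}_{\sigma,\gamma}(\mathit{crossPath})$ be the probability, starting from $\overline v$, of reaching $\widetilde U$ for some bottom strongly connected component (BSCC) $U$ of $G_{\sigma,\gamma}$. For a BSCC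 $U$ of $G_{\sigma,\gamma}$ with smallest priority $k=\min p(U)$ let $\widetilde{\Pr}^{k,\widetilde U}_{\sigma,\gamma}(\mathit{winEven})=\min_{x\in\widetilde U}\widetilde{\Pr}^{x}_{\sigma,\gamma}(\mathit{Reach}(v_{\mathrm{win}}))$ if $k$ is even, and $\widetilde{\Pr}^{k,\widetilde U}_{\sigma,\gamma}(\mathit{winOdd})=\max_{x\in\widetilde U}\widetilde{\Pr}^{x}_{\sigma,\gamma}(\mathit{Reach}(v_{\mathrm{win}}))$ if $k$ is odd. \textbf{Statement.} \begin{enumerate} \item If $\alpha_0\le\dfrac{\delta_{\min}^n}{8(n!)^2M^{2n^2}}$, then for all pairs $(\sigma,\gamma)$ of pure memoryless strategies and all $v\in V$, $$\widetilde{\Pr}^{\overline v}_{\sigma,\gamma}(\mathit{crossPath})>\frac{4-\epsilon}{4}.$$ \item If $\alpha_k>0$ and $\dfrac{\alpha_{k+1}}{\alpha_k}\le\dfrac{\delta_{\min}^n(1-\delta_{\min})}{8(n!)^2M^{2n^2}+1}$ for all $k\in\mathbb N$, then for all pairs $(\sigma,\gamma)$ of pure memoryless strategies and every BSCC $U$ of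 $G_{\sigma,\gamma}$ with smallest priority $k$, $$\widetilde{\Pr}^{k,\widetilde U}_{\sigma,\gamma}(\mathit{winEven})\ge\frac{4}{4+\epsilon}\ \text{ if $k$ is even},\qquad \widetilde{\Pr}^{k,\widetilde U}_{\sigma,\gamma}(\mathit{winOdd})\le 1-\frac{4}{4+\epsilon}\ \text{ if $k$ is odd}.$$ \end{enumerate} -/

import Mathlib

open scoped ENNReal

noncomputable section

namespace StochasticGame

/-! ### Discrete-time Markov chains

A Markov chain on `V` is given by its transition function `V → PMF V`; the initial state is always
an explicit argument. -/

/-- The probability of a finite sequence of states: the product of its one-step probabilities. -/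
def pathProb {V : Type*} (M : V → PMF V) : List V → ℝ≥0∞
  | [] => 1
  | [_] => 1
  | u :: v :: l => M u v * pathProb M (v :: l)

/-- The finite sequences in `(V \ T)* T` that start in `v`. (Those which are not paths of a given
chain, i.e. which contain a step of probability zero, have probability zero.) -/
def firstHitPaths {V : Type*} (T : Set V) (v : V) : Set (List V) :=
  {π | π.head? = some v ∧ ∃ (w : List V) (t : V), π = w ++ [t] ∧ (∀ x ∈ w, x ∉ T) ∧ t ∈ T}

/-- `Pr^v(Reach(T))`, the total probability of all finite paths from `v` that end with the first
visit of `T`. -/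
def reachProb {V : Type*} (M : V → PMF V) (v : V) (T : Set V) : ℝ :=
  (∑' π : firstHitPaths T v, pathProb M (π : List V)).toReal

/-- Any two states of `L` are reachable from each other in at least one step. -/
def StronglyConnected {V : Type*} (M : V → PMF V) (L : Set V) : Prop :=
  ∀ u ∈ L, ∀ v ∈ L, Relation.TransGen (fun x y => 0 < M x y) u v

/-- Bottom strongly connected components: nonempty maximal strongly connected sets that no
transition leaves. -/
def IsBSCC {V : Type*} (M : V → PMF V) (L : Set V) : Prop :=
  L.Nonempty ∧ Maximal (StronglyConnected M) L ∧ ∀ u ∈ L, ∀ v ∉ L, M u v = 0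

/-! ### Stochastic arenas -/

/-- The owner of a vertex; this encodes the partition of the vertices into three sets. -/
inductive Owner
  | eve
  | adam
  | random

/-- A stochastic arena with vertex set `V`. -/
structure Arena (V : Type*) where
  /-- the edge relation -/
  E : V → V → Prop
  /-- the partition into Eve's, Adam's and random vertices -/
  owner : V → Owner
  /-- the probabilistic transition function on the random vertices -/
  Δ : {v : V // owner v = Owner.random} → PMF V
  /-- the edges leaving a random vertex are the transitions of positive probability -/
  edge_iff : ∀ (u : {v : V // owner v = Owner.random}) (v : V), E u v ↔ v ∈ (Δ u).support
  /-- every vertex has a successor -/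
  nonblocking : ∀ u, ∃ v, E u v

namespace Arena

variable {V : Type*}

/-- Pure memoryless strategies of the player `o`: a successor for each vertex of that player. -/
structure Strategy (G : Arena V) (o : Owner) where
  /-- the chosen successor -/
  next : {v : V // G.owner v = o} → V
  /-- only edges of the arena are chosen -/
  edge : ∀ v : {v : V // G.owner v = o}, G.E v (next v)

/-- The Markov chain `G_{σ,γ}` that a pair of pure memoryless strategies of Eve and Adam induces. -/
def chain (G : Arena V) (σ : G.Strategy Owner.eve) (γ : G.Strategy Owner.adam) (v : V) : PMF V :=
  match h : G.owner v with
  | Owner.eve => PMF.pure (σ.next ⟨v, h⟩)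
  | Owner.adam => PMF.pure (γ.next ⟨v, h⟩)
  | Owner.random => G.Δ ⟨v, h⟩

/-- `δ_min`, the smallest positive value of the probabilistic transition function. -/
def deltaMin (G : Arena V) : ℝ :=
  sInf {x | ∃ (u : {v : V // G.owner v = Owner.random}) (v : V), x = (G.Δ u v).toReal ∧ 0 < x}

/-- `M`, the largest of the denominators `den u v` over the edges `(u, v)` at random vertices `u`. -/
def maxDen (G : Arena V) (den : {v : V // G.owner v = Owner.random} → V → ℕ) : ℕ :=
  sSup {m | ∃ (u : {v : V // G.owner v = Owner.random}) (v : V), G.E u v ∧ m = den u v}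

end Arena

/-! ### The gadget -/

/-- The vertices of the game built from the gadget: copies `hat v` and `bar v` of each vertex `v`,
and a winning and a losing sink. -/
inductive GVertex (V : Type*)
  | hat (v : V)
  | bar (v : V)
  | win
  | lose

open GVertex

/-- The distribution on `Bool` with mass `a` at `true` and `1 - a` at `false`. -/
def coin (a : unitInterval) : PMF Bool :=
  PMF.ofFintype (fun b => if b then ENNReal.ofReal a else ENNReal.ofReal (1 - a)) (by
    have h1 : (0 : ℝ) ≤ 1 - a := by linarith [a.2.2]
    simp [← ENNReal.ofReal_add a.2.1 h1])

/-- The transitions of `hat v`: with probability `α (p v)` to the winning sink (`p v` even) or to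
the losing sink (`p v` odd), otherwise to `bar v`. -/
def hatStep {V : Type*} (p : V → ℕ) (α : ℕ → unitInterval) (v : V) : PMF (GVertex V) :=
  (coin (α (p v))).map fun b => if b then (if Even (p v) then win else lose) else bar v

/-- The edges of the gadget game. At `hat v` these are the transitions of positive probability,
i.e. for `0 < α (p v) < 1` the edges to `bar v` and to the sink that belongs to the parity of
`p v`. -/
def gadgetEdge {V : Type*} (G : Arena V) (p : V → ℕ) (α : ℕ → unitInterval) :
    GVertex V → GVertex V → Prop
  | bar u, hat v => G.E u v
  | hat v, x => x ∈ (hatStep p α v).support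
  | win, win => True
  | lose, lose => True
  | _, _ => False

/-- The owners in the gadget game: `bar v` belongs to the owner of `v`; all other vertices are
random. -/
def gadgetOwner {V : Type*} (G : Arena V) : GVertex V → Owner
  | bar u => G.owner u
  | _ => Owner.random

/-- The probabilistic transition function of the gadget game. -/
def gadgetStep {V : Type*} (G : Arena V) (p : V → ℕ) (α : ℕ → unitInterval) :
    {x : GVertex V // gadgetOwner G x = Owner.random} → PMF (GVertex V)
  | ⟨bar u, h⟩ => (G.Δ ⟨u, h⟩).map hat
  | ⟨hat v, _⟩ => hatStep p α v
  | ⟨win, _⟩ => PMF.pure win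
  | ⟨lose, _⟩ => PMF.pure lose

/-- The arena obtained from `G` by inserting the gadget into every transition. -/
def gadget {V : Type*} (G : Arena V) (p : V → ℕ) (α : ℕ → unitInterval) : Arena (GVertex V) where
  E := gadgetEdge G p α
  owner := gadgetOwner G
  Δ := gadgetStep G p α
  edge_iff := by
    rintro ⟨x, h⟩ y
    cases x with
    | bar u =>
      have hG := G.edge_iff ⟨u, h⟩
      cases y <;> simp_all [gadgetEdge, gadgetStep]
    | hat v => cases y <;> simp [gadgetEdge, gadgetStep]
    | win => cases y <;> simp [gadgetEdge, gadgetStep]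
    | lose => cases y <;> simp [gadgetEdge, gadgetStep]
  nonblocking := by
    intro x
    cases x with
    | bar u =>
      obtain ⟨v, hv⟩ := G.nonblocking u
      exact ⟨hat v, hv⟩
    | hat v =>
      obtain ⟨y, hy⟩ := (hatStep p α v).support_nonempty
      exact ⟨y, by cases y <;> exact hy⟩
    | win => exact ⟨win, trivial⟩
    | lose => exact ⟨lose, trivial⟩

/-- A strategy in `G`, read as a strategy in the gadget game: if it moves from `u` to `v` then it
moves from `bar u` to `hat v`. -/
def liftStrategy {V : Type*} (G : Arena V) (p : V → ℕ) (α : ℕ → unitInterval) (o : Owner)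
    (ho : o ≠ Owner.random) (s : G.Strategy o) : (gadget G p α).Strategy o where
  next := fun x => match x with
    | ⟨bar u, h⟩ => hat (s.next ⟨u, h⟩)
    | ⟨hat _, h⟩ => absurd h.symm ho
    | ⟨win, h⟩ => absurd h.symm ho
    | ⟨lose, h⟩ => absurd h.symm ho
  edge := by
    rintro ⟨x, h⟩
    cases x with
    | bar u => exact s.edge ⟨u, h⟩
    | hat _ => exact absurd h.symm ho
    | win => exact absurd h.symm ho
    | lose => exact absurd h.symm ho

/-- The Markov chain that the strategies `σ`, `γ` of `G` induce in the gadget game. -/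
def gadgetChain {V : Type*} (G : Arena V) (p : V → ℕ) (α : ℕ → unitInterval)
    (σ : G.Strategy Owner.eve) (γ : G.Strategy Owner.adam) : GVertex V → PMF (GVertex V) :=
  (gadget G p α).chain (liftStrategy G p α Owner.eve (by simp) σ)
    (liftStrategy G p α Owner.adam (by simp) γ)

/-- The set of all copies `bar u` and `hat u` of the vertices `u ∈ U`. -/
def tildeSet {V : Type*} (U : Set V) : Set (GVertex V) := bar '' U ∪ hat '' U

/-- The probability of reaching, from `bar v` in the gadget game, the copy `tildeSet U` of some
bottom strongly connected component `U` of `G_{σ,γ}`. -/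
def crossPath {V : Type*} (G : Arena V) (p : V → ℕ) (α : ℕ → unitInterval)
    (σ : G.Strategy Owner.eve) (γ : G.Strategy Owner.adam) (v : V) : ℝ :=
  reachProb (gadgetChain G p α σ γ) (bar v) (⋃ U ∈ {U | IsBSCC (G.chain σ γ) U}, tildeSet U)

/-- The minimal probability of reaching the winning sink from a vertex of `tildeSet U`. -/
def winEven {V : Type*} (G : Arena V) (p : V → ℕ) (α : ℕ → unitInterval)
    (σ : G.Strategy Owner.eve) (γ : G.Strategy Owner.adam) (U : Set V) : ℝ :=
  sInf ((fun x => reachProb (gadgetChain G p α σ γ) x {win}) '' tildeSet U)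

/-- The maximal probability of reaching the winning sink from a vertex of `tildeSet U`. -/
def winOdd {V : Type*} (G : Arena V) (p : V → ℕ) (α : ℕ → unitInterval)
    (σ : G.Strategy Owner.eve) (γ : G.Strategy Owner.adam) (U : Set V) : ℝ :=
  sSup ((fun x => reachProb (gadgetChain G p α σ γ) x {win}) '' tildeSet U)

/-- `ε = 1 / ((n!)² M^(2n²))`. -/
def epsilon (n M : ℕ) : ℝ := 1 / ((n.factorial : ℝ) ^ 2 * (M : ℝ) ^ (2 * n ^ 2))

end StochasticGame

end

/-! Both statements follow from one maximum principle on the finite chain `G_{σ,γ}`. If every state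
of a closed set `S` can reach `T`, a shortest path has at most `n - 1` steps, each of probability at
least `δ`. A function that exceeds its one-step average by at most `b` outside `T` then exceeds its
bound on `T` by at most `b * C`, where `C = 2 * (δ⁻¹ ^ (n - 1) - 1)` (`le_of_subharmonic_up_to`). No
expected hitting time is needed: an explicit function of the distance to `T` serves as potential.

For `crossPath`, `T` is the union of the BSCCs, and each passage through a `hat` vertex loses at
most `α 0`, so the failure probability is at most `α 0 * C` (`one_sub_crossPath_le`).

Inside a BSCC with least priority `k`, let `f` be the probability of missing the favourable outcome
from `hat v`. A visit to priority `k` multiplies it by `1 - α k`; any other vertex adds at most `α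
(k + 1)`. With `T` the vertices of priority `k`, the maximum `m` of `f` satisfies `m ≤ (1 - α k) * m
+ α (k + 1) * C`, hence `m ≤ α (k + 1) / α k * C` (`le_of_isBSCC`). Since `δ ^ n * C < 2 * δ`, the
assumed bounds on `α` finish both parts. -/

open scoped ENNReal

namespace StochasticGame

/-! ### Reachability probabilities -/

/-- `reachProb` before the conversion to a real number. -/
noncomputable def reachMass {V : Type*} (M : V → PMF V) (T : Set V) (v : V) : ℝ≥0∞ :=
  ∑' π : firstHitPaths T v, pathProb M (π : List V)

lemma reachProb_eq {V : Type*} (M : V → PMF V) (T : Set V) (v : V) :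
    reachProb M v T = (reachMass M T v).toReal := rfl

lemma firstHitPaths_of_mem {V : Type*} {T : Set V} {v : V} (hv : v ∈ T) :
    firstHitPaths T v = {[v]} := by
  ext π
  constructor
  · rintro ⟨h, w, t, rfl, hw, ht⟩
    cases w with
    | nil => simp_all
    | cons a w => simp_all
  · rintro rfl
    exact ⟨rfl, [], v, rfl, by simp, hv⟩

lemma cons_mem_firstHitPaths {V : Type*} {T : Set V} {v : V} (hv : v ∉ T) (π : List V) :
    π ∈ firstHitPaths T v ↔ ∃ w, ∃ l ∈ firstHitPaths T w, π = v :: l := by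
  constructor
  · rintro ⟨h, w, t, rfl, hw, ht⟩
    cases w with
    | nil => simp at h; subst h; exact absurd ht hv
    | cons a w =>
      obtain rfl : a = v := by simpa using h
      have hx : ∃ x, (w ++ [t]).head? = some x := by cases w <;> simp
      obtain ⟨x, hx⟩ := hx
      exact ⟨x, w ++ [t], ⟨hx, w, t, rfl, fun y hy => hw y (by simp [hy]), ht⟩, rfl⟩
  · rintro ⟨x, l, ⟨h, w, t, rfl, hw, ht⟩, rfl⟩
    refine ⟨rfl, v :: w, t, rfl, ?_, ht⟩
    intro y hy
    rcases List.mem_cons.1 hy with rfl | hy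
    · exact hv
    · exact hw y hy

lemma pathProb_cons {V : Type*} (M : V → PMF V) {v w : V} {l : List V} (h : l.head? = some w) :
    pathProb M (v :: l) = M v w * pathProb M l := by
  cases l with
  | nil => simp at h
  | cons a l => obtain rfl : a = w := by simpa using h
                rfl

/-- Paths in different `A w` differ in their heads, so prepending `v` is a bijection from the
disjoint union of the `A w` onto `B`. The sets are left general so that this covers paths of bounded
length too. -/
lemma tsum_cons_paths {V : Type*} (M : V → PMF V) (v : V) (A : V → Set (List V))
    (hA : ∀ w, ∀ l ∈ A w, l.head? = some w) (B : Set (List V))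
    (hB : ∀ π, π ∈ B ↔ ∃ w, ∃ l ∈ A w, π = v :: l) :
    ∑' π : B, pathProb M (π : List V) =
      ∑' w, M v w * ∑' π : A w, pathProb M (π : List V) := by
  let F : (Σ w, A w) → B := fun x => ⟨v :: x.2.1, (hB _).2 ⟨x.1, x.2.1, x.2.2, rfl⟩⟩
  have hF : Function.Bijective F := by
    constructor
    · rintro ⟨w, l, hl⟩ ⟨w', l', hl'⟩ h
      obtain rfl : l = l' := by simpa [F] using h
      obtain rfl : w = w' := by simpa [hA w l hl] using hA w' l hl'
      rfl
    · rintro ⟨π, hπ⟩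
      obtain ⟨w, l, hl, rfl⟩ := (hB π).1 hπ
      exact ⟨⟨w, l, hl⟩, rfl⟩
  rw [← (Equiv.ofBijective F hF).tsum_eq, ENNReal.tsum_sigma']
  refine tsum_congr fun w => ?_
  rw [← ENNReal.tsum_mul_left]
  exact tsum_congr fun l => pathProb_cons M (hA w l l.2)

lemma reachMass_of_mem {V : Type*} (M : V → PMF V) {T : Set V} {v : V} (hv : v ∈ T) :
    reachMass M T v = 1 := by
  rw [reachMass, firstHitPaths_of_mem hv, tsum_singleton [v] (pathProb M)]
  rfl

lemma reachMass_of_notMem {V : Type*} (M : V → PMF V) {T : Set V} {v : V} (hv : v ∉ T) :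
    reachMass M T v = ∑' w, M v w * reachMass M T w :=
  tsum_cons_paths M v (firstHitPaths T) (fun _ _ h => h.1) _ (cons_mem_firstHitPaths hv)

/-- The length cutoff turns the one-step equation into an induction; every finite partial sum of
`reachMass` obeys such a cutoff. -/
lemma tsum_bounded_firstHitPaths_le_one {V : Type*} (M : V → PMF V) (T : Set V) (N : ℕ) :
    ∀ v, ∑' π : {π | π ∈ firstHitPaths T v ∧ π.length ≤ N}, pathProb M (π : List V) ≤ 1 := by
  induction N with
  | zero =>
    intro v
    refine (ENNReal.tsum_eq_zero.2 ?_).le.trans zero_le_one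
    rintro ⟨_, ⟨-, w, t, rfl, -⟩, h⟩
    simp at h
  | succ N ih =>
    intro v
    by_cases hv : v ∈ T
    · refine le_trans (ENNReal.tsum_mono_subtype _ (t := firstHitPaths T v) fun _ h => h.1) ?_
      exact (reachMass_of_mem M hv).le
    · rw [tsum_cons_paths M v (fun w => {π | π ∈ firstHitPaths T w ∧ π.length ≤ N})
        (fun _ _ h => h.1.1)]
      · refine le_trans (ENNReal.tsum_le_tsum fun w => mul_le_mul_right (ih w) _) ?_
        simp [(M v).tsum_coe]
      · intro π
        simp only [Set.mem_ofPred_eq, cons_mem_firstHitPaths hv]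
        constructor
        · rintro ⟨⟨w, l, hl, rfl⟩, h⟩
          exact ⟨w, l, ⟨hl, by simpa using h⟩, rfl⟩
        · rintro ⟨w, l, ⟨hl, h⟩, rfl⟩
          exact ⟨⟨w, l, hl, rfl⟩, by simpa using h⟩

lemma reachMass_le_one {V : Type*} (M : V → PMF V) (T : Set V) (v : V) :
    reachMass M T v ≤ 1 := by
  rw [reachMass, ENNReal.tsum_eq_iSup_sum]
  refine iSup_le fun s => ?_
  let N := s.sup fun π => (π : List V).length
  refine le_trans ?_ (tsum_bounded_firstHitPaths_le_one M T N v)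
  let i : s → {π | π ∈ firstHitPaths T v ∧ π.length ≤ N} := fun π =>
    ⟨π.1.1, π.1.2, Finset.le_sup (f := fun π : firstHitPaths T v => (π : List V).length) π.2⟩
  have hi : Function.Injective i := by
    intro a b h
    apply Subtype.ext
    apply Subtype.ext
    simpa [i] using h
  calc ∑ π ∈ s, pathProb M (π : List V) = ∑' π : s, pathProb M ((i π : List V)) := by
        rw [tsum_fintype, ← Finset.sum_coe_sort]
    _ ≤ _ := ENNReal.tsum_comp_le_tsum_of_injective hi fun π => pathProb M (π : List V)

lemma reachMass_ne_top {V : Type*} (M : V → PMF V) (T : Set V) (v : V) :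
    reachMass M T v ≠ ∞ :=
  ((reachMass_le_one M T v).trans_lt ENNReal.one_lt_top).ne

lemma reachProb_nonneg {V : Type*} (M : V → PMF V) (T : Set V) (v : V) :
    0 ≤ reachProb M v T := ENNReal.toReal_nonneg

lemma reachProb_le_one {V : Type*} (M : V → PMF V) (T : Set V) (v : V) :
    reachProb M v T ≤ 1 :=
  ENNReal.toReal_le_of_le_ofReal zero_le_one (by rw [ENNReal.ofReal_one]; exact reachMass_le_one M T v)

lemma reachProb_of_mem {V : Type*} (M : V → PMF V) {T : Set V} {v : V} (hv : v ∈ T) :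
    reachProb M v T = 1 := by
  rw [reachProb_eq, reachMass_of_mem M hv, ENNReal.toReal_one]

lemma reachProb_absorbing {V : Type*} (M : V → PMF V) {T : Set V} {v : V} (hv : v ∉ T)
    (hM : M v = PMF.pure v) : reachProb M v T = 0 := by
  have key : ∀ w : List V, ∀ t ∈ T, (w ++ [t]).head? = some v → pathProb M (w ++ [t]) = 0 := by
    intro w t ht
    induction w with
    | nil => intro h; simp at h; subst h; exact absurd ht hv
    | cons a w ih =>
      intro h
      obtain rfl : a = v := by simpa using h
      obtain ⟨x, hx⟩ : ∃ x, (w ++ [t]).head? = some x := by cases w <;> simp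
      rw [List.cons_append, pathProb_cons M hx]
      by_cases hxa : x = a
      · subst hxa; rw [ih hx, mul_zero]
      · rw [hM, PMF.pure_apply, if_neg hxa, zero_mul]
  have : reachMass M T v = 0 := by
    rw [reachMass, ENNReal.tsum_eq_zero]
    rintro ⟨π, h, w, t, rfl, -, ht⟩
    exact key w t ht h
  rw [reachProb_eq, this, ENNReal.toReal_zero]

/-- One step of a chain whose transition at `v` is the image of a distribution on a finite set. -/
lemma reachProb_of_map {V ι : Type*} [Fintype ι] (M : V → PMF V) {T : Set V} {v : V} (hv : v ∉ T)
    (q : PMF ι) (f : ι → V) (hM : M v = q.map f) :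
    reachProb M v T = ∑ i, (q i).toReal * reachProb M (f i) T := by
  have h : reachMass M T v = ∑ i, q i * reachMass M T (f i) := by
    rw [reachMass_of_notMem M hv, hM]
    simp_rw [PMF.map_apply, ← ENNReal.tsum_mul_right]
    rw [ENNReal.tsum_comm, tsum_fintype]
    refine Finset.sum_congr rfl fun i _ => ?_
    rw [tsum_eq_single (f i)]
    · simp
    · intro b hb; simp [hb]
  rw [reachProb_eq, h, ENNReal.toReal_sum]
  · simp [reachProb_eq]
  · intro i _
    exact ENNReal.mul_ne_top (q.apply_ne_top i) (reachMass_ne_top M T _)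

/-! ### Finite graphs -/

lemma exists_rank {V : Type*} [Fintype V] (step : V → V → Prop) (T : Set V) :
    ∃ d : V → ℕ, ∀ v, (∃ t ∈ T, Relation.ReflTransGen step v t) →
      d v < Fintype.card V ∧ (v ∉ T → ∃ w, step v w ∧ d w < d v) := by
  classical
  -- `D k v`: some walk of exactly `k` steps leads from `v` into `T`. Where there is none, `d v` is
  -- the junk value `sInf ∅ = 0`, so `D (d v) v` is carried along below.
  let D : ℕ → V → Prop := fun k => Nat.rec (fun v => v ∈ T) (fun _ D v => ∃ w, step v w ∧ D w) k
  let d : V → ℕ := fun v => sInf {k | D k v}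
  have hle : ∀ {k v}, D k v → d v ≤ k := fun h => Nat.sInf_le h
  have hmem : ∀ {k v}, D k v → D (d v) v := fun {k v} h => Nat.sInf_mem (s := {k | D k v}) ⟨k, h⟩
  have hD : ∀ v, (∃ t ∈ T, Relation.ReflTransGen step v t) → ∃ k, D k v := by
    rintro v ⟨t, ht, h⟩
    induction h using Relation.ReflTransGen.head_induction_on with
    | refl => exact ⟨0, ht⟩
    | head hs _ ih => obtain ⟨k, hk⟩ := ih; exact ⟨k + 1, _, hs, hk⟩
  have hpred : ∀ k v, D (d v) v → d v = k + 1 → ∃ w, step v w ∧ d w = k ∧ D (d w) w := by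
    intro k v hv hk
    rw [hk] at hv
    obtain ⟨w, hs, hw⟩ := hv
    refine ⟨w, hs, le_antisymm (hle hw) ?_, hmem hw⟩
    have : d v ≤ d w + 1 := hle ⟨w, hs, hmem hw⟩
    omega
  -- A shortest walk passes through every smaller distance, so `d` takes at least `d v + 1` values
  -- and `d v < Fintype.card V`.
  have hall : ∀ k v, D (d v) v → d v = k → ∀ j ≤ k, ∃ w, d w = j := by
    intro k
    induction k with
    | zero => intro v _ h j hj; exact ⟨v, by omega⟩
    | succ k ih =>
      intro v hv h j hj
      obtain ⟨w, -, hw, hDw⟩ := hpred k v hv h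
      rcases Nat.lt_or_ge k j with h' | h'
      · exact ⟨v, by omega⟩
      · exact ih w hDw hw j h'
  refine ⟨d, fun v hv => ?_⟩
  obtain ⟨k, hk⟩ := hD v hv
  have hv' := hmem hk
  constructor
  · have hsub : Finset.range (d v + 1) ⊆ Finset.univ.image d := by
      intro j hj
      obtain ⟨w, hw⟩ := hall _ v hv' rfl j (by simpa [Nat.lt_succ_iff] using hj)
      exact Finset.mem_image.2 ⟨w, Finset.mem_univ _, hw⟩
    have := (Finset.card_le_card hsub).trans Finset.card_image_le
    simpa [Nat.succ_le_iff] using this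
  · intro hT
    rcases h0 : d v with _ | m
    · rw [h0] at hv'; exact absurd hv' hT
    · obtain ⟨w, hs, hw, -⟩ := hpred m v hv' h0
      exact ⟨w, hs, by omega⟩

/-- Among the states reachable from `v`, one with the fewest successors under `TransGen` has a
successor set that cannot shrink further, and this set is a BSCC. The minimiser itself may be
transient and lie outside it. -/
lemma exists_isBSCC_reachable {V : Type*} [Fintype V] (M : V → PMF V) (v : V) :
    ∃ L, IsBSCC M L ∧ ∃ u ∈ L, Relation.ReflTransGen (fun x y => 0 < M x y) v u := by
  classical
  let R : V → Set V := fun u => {w | Relation.TransGen (fun x y => 0 < M x y) u w}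
  obtain ⟨u, hu, hmin⟩ := Set.exists_min_image
    {u | Relation.ReflTransGen (fun x y => 0 < M x y) v u} (fun u => (R u).ncard)
    (Set.toFinite _) ⟨v, Relation.ReflTransGen.refl⟩
  have hR : ∀ w ∈ R u, R w = R u := by
    intro w hw
    refine Set.eq_of_subset_of_ncard_le (fun x hx => Relation.TransGen.trans hw hx) ?_
      (Set.toFinite _)
    exact hmin w (Relation.ReflTransGen.trans hu hw.to_reflTransGen)
  obtain ⟨w, hw⟩ := (M u).support_nonempty
  have hw' : w ∈ R u := Relation.TransGen.single (pos_iff_ne_zero.2 hw)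
  refine ⟨R u, ⟨⟨w, hw'⟩, ⟨?_, ?_⟩, ?_⟩, w, hw', hu.trans hw'.to_reflTransGen⟩
  · intro x hx y hy
    rw [← hR x hx] at hy
    exact hy
  · intro L' hL' hsub x hx
    have : x ∈ R w := hL' w (hsub hw') x hx
    rwa [hR w hw'] at this
  · intro x hx y hy
    by_contra h
    exact hy (Relation.TransGen.tail hx (pos_iff_ne_zero.2 h))

/-! ### A potential bound -/

/-- If `f` exceeds its one-step average by at most `b` outside `T`, and `T` can be reached from
everywhere in the closed set `S`, then `f` exceeds its bound on `T` by at most `b` times the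
worst-case expected number of steps to `T`. -/
lemma le_of_subharmonic_up_to {V : Type*} [Fintype V] (P : V → V → ℝ) (hP : ∀ v w, 0 ≤ P v w)
    (hP1 : ∀ v, ∑ w, P v w = 1) {δ : ℝ} (hδ : 0 < δ) (hδ2 : δ ≤ 1 / 2)
    (hPδ : ∀ v w, 0 < P v w → δ ≤ P v w) {S T : Set V}
    (hS : ∀ v ∈ S, ∀ w, 0 < P v w → w ∈ S)
    (hT : ∀ v ∈ S, ∃ t ∈ T, Relation.ReflTransGen (fun x y => 0 < P x y) v t)
    (f : V → ℝ) {b m : ℝ} (hb : 0 ≤ b) (hfT : ∀ v ∈ S, v ∈ T → f v ≤ m)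
    (hf : ∀ v ∈ S, v ∉ T → f v ≤ b + ∑ w, P v w * f w) :
    ∀ v ∈ S, f v ≤ m + b * (2 * (δ⁻¹ ^ (Fintype.card V - 1) - 1)) := by
  obtain ⟨d, hd⟩ := exists_rank (fun x y => 0 < P x y) T
  set t := Fintype.card V - 1
  have hδ1 : 1 ≤ δ⁻¹ := (one_le_inv₀ hδ).2 (by linarith)
  -- The potential at distance `i` from `T`: it solves `δ * e i = e (i + 1) + 2 - 2 * δ`, so `δ ≤ 1
  -- / 2` gives a mean gain of at least 1 from the single step towards `T`, all other successors
  -- contributing at least 0.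
  let e : ℕ → ℝ := fun i => 2 * (δ⁻¹ ^ (t - i) - 1)
  have he0 : ∀ i, 0 ≤ e i := fun i => by
    have := one_le_pow₀ hδ1 (n := t - i)
    simp only [e]; linarith
  have hanti : ∀ {i j}, i ≤ j → e j ≤ e i := fun {i j} h => by
    have := pow_le_pow_right₀ hδ1 (show t - j ≤ t - i by omega)
    simp only [e]; linarith
  have hstep : ∀ i, i < t → 1 + e (i + 1) ≤ δ * e i := by
    intro i hi
    have h1 : t - i = (t - (i + 1)) + 1 := by omega
    simp only [e, h1, pow_succ]
    have : δ * (2 * (δ⁻¹ ^ (t - (i + 1)) * δ⁻¹ - 1)) = 2 * δ⁻¹ ^ (t - (i + 1)) - 2 * δ := by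
      field_simp
    linarith
  have hE : ∀ v ∈ S, v ∉ T → 1 + e (d v) ≤ ∑ w, P v w * e (d w) := by
    intro v hv hvT
    obtain ⟨h1, h2⟩ := hd v (hT v hv)
    obtain ⟨w, hw, hlt⟩ := h2 hvT
    obtain ⟨i, hi⟩ : ∃ i, d v = i + 1 := ⟨d v - 1, by omega⟩
    calc 1 + e (d v) ≤ δ * e i := by rw [hi]; exact hstep i (by omega)
      _ ≤ P v w * e (d w) := by
        exact mul_le_mul (hPδ v w hw) (hanti (by omega)) (he0 _) (hP v w)
      _ ≤ _ := Finset.single_le_sum (f := fun w => P v w * e (d w))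
        (fun w _ => mul_nonneg (hP v w) (he0 _)) (Finset.mem_univ w)
  -- Outside `T`, `f + c * e ∘ d` lies strictly below its one-step average, so its maximum over `S`
  -- is attained in `T`. Strictness needs `c > b`; afterwards `c` tends to `b`.
  have key : ∀ c, b < c → ∀ v ∈ S, f v ≤ m + c * (e 0 - e (d v)) := by
    intro c hc v hv
    obtain ⟨x, hx, hmax⟩ := Set.exists_max_image S (fun v => f v + c * e (d v))
      (Set.toFinite S) ⟨v, hv⟩
    have hxT : x ∈ T := by
      by_contra hxT
      have h1 := hf x hx hxT
      have h2 := mul_le_mul_of_nonneg_left (hE x hx hxT) (hb.trans hc.le)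
      have h3 : ∑ w, P x w * (f w + c * e (d w)) ≤ ∑ w, P x w * (f x + c * e (d x)) := by
        refine Finset.sum_le_sum fun w _ => ?_
        rcases (hP x w).eq_or_lt with h0 | h0
        · simp [← h0]
        · exact mul_le_mul_of_nonneg_left (hmax w (hS x hx w h0)) (hP x w)
      have h4 : ∑ w, P x w * (f w + c * e (d w)) =
          ∑ w, P x w * f w + c * ∑ w, P x w * e (d w) := by
        rw [Finset.mul_sum, ← Finset.sum_add_distrib]
        exact Finset.sum_congr rfl fun w _ => by ring
      rw [← Finset.sum_mul, hP1, h4] at h3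
      linarith
    have h1 := hmax v hv
    have h2 := hfT x hx hxT
    have h3 := mul_le_mul_of_nonneg_left (hanti (Nat.zero_le (d x))) (hb.trans hc.le)
    linarith
  intro v hv
  have hC : e 0 = 2 * (δ⁻¹ ^ t - 1) := rfl
  rw [← hC]
  refine le_of_forall_pos_le_add fun η hη => ?_
  have hpos : 0 < e 0 + 1 := by linarith [he0 0]
  have h := key (b + η / (e 0 + 1)) (by linarith [div_pos hη hpos]) v hv
  have h1 : η / (e 0 + 1) * e 0 ≤ η := by
    rw [div_mul_eq_mul_div, div_le_iff₀ hpos]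
    nlinarith [he0 0]
  have h2 : 0 ≤ (b + η / (e 0 + 1)) * e (d v) :=
    mul_nonneg (by linarith [div_pos hη hpos]) (he0 _)
  nlinarith

/-! ### The chains induced by strategies -/

namespace Arena

variable {V : Type*} (G : Arena V) (σ : G.Strategy Owner.eve) (γ : G.Strategy Owner.adam)

lemma chain_of_eve {v : V} (h : G.owner v = Owner.eve) :
    G.chain σ γ v = PMF.pure (σ.next ⟨v, h⟩) := by
  unfold chain
  split
  · rfl
  · rename_i h'; exact nomatch h.symm.trans h'
  · rename_i h'; exact nomatch h.symm.trans h'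

lemma chain_of_adam {v : V} (h : G.owner v = Owner.adam) :
    G.chain σ γ v = PMF.pure (γ.next ⟨v, h⟩) := by
  unfold chain
  split
  · rename_i h'; exact nomatch h.symm.trans h'
  · rfl
  · rename_i h'; exact nomatch h.symm.trans h'

lemma chain_of_random {v : V} (h : G.owner v = Owner.random) :
    G.chain σ γ v = G.Δ ⟨v, h⟩ := by
  unfold chain
  split
  · rename_i h'; exact nomatch h.symm.trans h'
  · rename_i h'; exact nomatch h.symm.trans h'
  · rfl

lemma deltaMin_le {u : {v : V // G.owner v = Owner.random}} {v : V}
    (h : 0 < (G.Δ u v).toReal) : G.deltaMin ≤ (G.Δ u v).toReal :=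
  csInf_le ⟨0, by rintro _ ⟨_, _, -, h⟩; exact h.le⟩ ⟨u, v, rfl, h⟩

/-- Moves chosen by a player have probability 1, hence the assumption `G.deltaMin ≤ 1`. -/
lemma deltaMin_le_chain (hδ : G.deltaMin ≤ 1) {v w : V} (h : 0 < (G.chain σ γ v w).toReal) :
    G.deltaMin ≤ (G.chain σ γ v w).toReal := by
  classical
  have hpure : ∀ x y : V, 0 < (PMF.pure x y).toReal → G.deltaMin ≤ (PMF.pure x y).toReal := by
    intro x y hxy
    rw [PMF.pure_apply] at hxy ⊢
    split_ifs at hxy ⊢ <;> simp_all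
  rcases ho : G.owner v with _ | _ | _
  · rw [chain_of_eve G σ γ ho] at h ⊢; exact hpure _ _ h
  · rw [chain_of_adam G σ γ ho] at h ⊢; exact hpure _ _ h
  · rw [chain_of_random G σ γ ho] at h ⊢; exact G.deltaMin_le h

/-- As `sInf ∅ = 0` in `ℝ`, a positive `deltaMin` forces a random transition to exist, so the
supremum is over a nonempty finite set of positive numbers. -/
lemma one_le_maxDen [Finite V] (hδ : 0 < G.deltaMin)
    (den : {v : V // G.owner v = Owner.random} → V → ℕ) (hden : ∀ u v, 0 < den u v) :
    1 ≤ G.maxDen den := by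
  have hne : {x | ∃ (u : {v : V // G.owner v = Owner.random}) (v : V),
      x = (G.Δ u v).toReal ∧ 0 < x}.Nonempty := by
    by_contra h
    rw [Set.not_nonempty_iff_eq_empty] at h
    rw [deltaMin, h, Real.sInf_empty] at hδ
    exact hδ.false
  obtain ⟨_, u, v, rfl, h⟩ := hne
  refine (hden u v).trans_le (le_csSup (Set.Finite.bddAbove ?_) ⟨u, v, ?_, rfl⟩)
  · refine (Set.finite_range fun x : {v : V // G.owner v = Owner.random} × V =>
      den x.1 x.2).subset ?_
    rintro _ ⟨u, v, -, rfl⟩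
    exact ⟨(u, v), rfl⟩
  · rw [G.edge_iff, PMF.mem_support_iff]
    intro h0
    simp [h0] at h

end Arena

open GVertex

/-! ### Recurrences in the gadget chain, and the bounds for crossing and winning -/

section gadget

variable {V : Type*} (G : Arena V) (p : V → ℕ) (α : ℕ → unitInterval)
  (σ : G.Strategy Owner.eve) (γ : G.Strategy Owner.adam)

lemma gadgetChain_bar (v : V) :
    gadgetChain G p α σ γ (bar v) = (G.chain σ γ v).map hat := by
  rcases ho : G.owner v with _ | _ | _
  · rw [Arena.chain_of_eve G σ γ ho, PMF.pure_map]
    exact Arena.chain_of_eve (gadget G p α) _ _ (v := bar v) ho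
  · rw [Arena.chain_of_adam G σ γ ho, PMF.pure_map]
    exact Arena.chain_of_adam (gadget G p α) _ _ (v := bar v) ho
  · rw [Arena.chain_of_random G σ γ ho]
    exact Arena.chain_of_random (gadget G p α) _ _ (v := bar v) ho

lemma gadgetChain_hat (v : V) : gadgetChain G p α σ γ (hat v) = hatStep p α v :=
  Arena.chain_of_random (gadget G p α) _ _ (v := hat v) rfl

lemma gadgetChain_lose : gadgetChain G p α σ γ lose = PMF.pure lose :=
  Arena.chain_of_random (gadget G p α) _ _ (v := lose) rfl

lemma reachProb_bar [Fintype V] {T : Set (GVertex V)} {v : V} (hv : bar v ∉ T) :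
    reachProb (gadgetChain G p α σ γ) (bar v) T =
      ∑ w, (G.chain σ γ v w).toReal * reachProb (gadgetChain G p α σ γ) (hat w) T :=
  reachProb_of_map _ hv _ _ (gadgetChain_bar G p α σ γ v)

lemma reachProb_hat {T : Set (GVertex V)} {v : V} (hv : hat v ∉ T) :
    reachProb (gadgetChain G p α σ γ) (hat v) T =
      α (p v) * reachProb (gadgetChain G p α σ γ) (if Even (p v) then win else lose) T +
      (1 - α (p v)) * reachProb (gadgetChain G p α σ γ) (bar v) T := by
  rw [reachProb_of_map _ hv _ _ (gadgetChain_hat G p α σ γ v)]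
  have h1 : (0 : ℝ) ≤ 1 - α (p v) := by linarith [(α (p v)).2.2]
  simp [coin, PMF.ofFintype_apply, ENNReal.toReal_ofReal (α (p v)).2.1, ENNReal.toReal_ofReal h1]

lemma sum_toReal_chain [Fintype V] (v : V) : ∑ w, (G.chain σ γ v w).toReal = 1 := by
  rw [← ENNReal.toReal_sum fun w _ => PMF.apply_ne_top _ w, ← tsum_fintype (L := .unconditional V),
    PMF.tsum_coe,
    ENNReal.toReal_one]

lemma toReal_chain_pos {v w : V} : 0 < (G.chain σ γ v w).toReal ↔ 0 < G.chain σ γ v w := by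
  rw [ENNReal.toReal_pos_iff]
  exact and_iff_left (lt_top_iff_ne_top.2 (PMF.apply_ne_top _ w))

lemma pow_mul_two_mul_inv_pow_sub_one_lt {δ : ℝ} (hδ : 0 < δ) {n : ℕ} (hn : 1 ≤ n) :
    δ ^ n * (2 * (δ⁻¹ ^ (n - 1) - 1)) < 2 * δ := by
  obtain ⟨m, rfl⟩ : ∃ m, n = m + 1 := ⟨n - 1, by omega⟩
  have h : δ ^ m * δ⁻¹ ^ m = 1 := by rw [← mul_pow, mul_inv_cancel₀ hδ.ne', one_pow]
  have h2 : δ ^ (m + 1) * (2 * (δ⁻¹ ^ m - 1)) = 2 * δ * (δ ^ m * δ⁻¹ ^ m) - 2 * δ ^ (m + 1) := by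
    ring
  rw [Nat.add_sub_cancel, h2, h]
  linarith [pow_pos hδ (m + 1)]

lemma one_sub_crossPath_le [Fintype V] (hα : Antitone α) (hδ : 0 < G.deltaMin)
    (hδ2 : G.deltaMin ≤ 1 / 2) (v : V) :
    1 - crossPath G p α σ γ v ≤
      α 0 * (2 * (G.deltaMin⁻¹ ^ (Fintype.card V - 1) - 1)) := by
  set W : Set (GVertex V) := ⋃ U ∈ {U | IsBSCC (G.chain σ γ) U}, tildeSet U with hW
  have hbar : ∀ x, bar x ∈ W ↔ ∃ U, IsBSCC (G.chain σ γ) U ∧ x ∈ U := by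
    intro x; simp [hW, tildeSet]
  have hstep : ∀ w, reachProb (gadgetChain G p α σ γ) (bar w) W - α 0 ≤
      reachProb (gadgetChain G p α σ γ) (hat w) W := by
    intro w
    by_cases hw : hat w ∈ W
    · rw [reachProb_of_mem _ hw]
      linarith [reachProb_le_one (gadgetChain G p α σ γ) W (bar w), (α 0).2.1]
    · rw [reachProb_hat G p α σ γ hw]
      have h1 := reachProb_nonneg (gadgetChain G p α σ γ) W
        (if Even (p w) then win else lose)
      have h2 := mul_nonneg (α (p w)).2.1 h1
      have h3 : (α (p w) : ℝ) ≤ α 0 := hα (Nat.zero_le _)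
      have h4 := mul_le_mul_of_nonneg_left
        (reachProb_le_one (gadgetChain G p α σ γ) W (bar w)) (α (p w)).2.1
      linarith
  -- Applied to the failure probability from `bar x`, which vanishes on the BSCCs and grows by at
  -- most `α 0` per step.
  have := le_of_subharmonic_up_to (fun v w => (G.chain σ γ v w).toReal)
    (fun _ _ => ENNReal.toReal_nonneg) (sum_toReal_chain G σ γ) hδ hδ2
    (fun v w h => G.deltaMin_le_chain σ γ (by linarith) h)
    (S := Set.univ) (T := {x | bar x ∈ W}) (fun _ _ _ _ => trivial) ?_
    (fun x => 1 - reachProb (gadgetChain G p α σ γ) (bar x) W) (b := α 0) (m := 0) (α 0).2.1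
    ?_ ?_ v trivial
  · rw [zero_add] at this
    exact this
  · intro x _
    obtain ⟨L, hL, u, hu, hr⟩ := exists_isBSCC_reachable (G.chain σ γ) x
    exact ⟨u, (hbar u).2 ⟨L, hL, hu⟩, Relation.ReflTransGen.mono (fun _ _ h => (toReal_chain_pos G σ γ).2 h) _ _ hr⟩
  · intro x _ hx
    have hx' : bar x ∈ W := hx
    rw [reachProb_of_mem _ hx', sub_self]
  · intro x _ hx
    have hx' : bar x ∉ W := hx
    have h1 : ∑ w, (G.chain σ γ x w).toReal *
        (reachProb (gadgetChain G p α σ γ) (bar w) W - α 0) ≤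
        reachProb (gadgetChain G p α σ γ) (bar x) W := by
      rw [reachProb_bar G p α σ γ hx']
      exact Finset.sum_le_sum fun w _ =>
        mul_le_mul_of_nonneg_left (hstep w) ENNReal.toReal_nonneg
    simp only [mul_sub, Finset.sum_sub_distrib, ← Finset.sum_mul, sum_toReal_chain, mul_one,
      one_mul] at h1 ⊢
    linarith

/-- Inside a bottom strongly connected component with smallest priority `k`: a function on its
vertices that decreases by the factor `1 - α k` at priority `k`, and grows by at most `α (k + 1)`
elsewhere, is small. -/
lemma le_of_isBSCC [Fintype V] (hδ : 0 < G.deltaMin) (hδ2 : G.deltaMin ≤ 1 / 2) {U : Set V}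
    {k : ℕ} (hU : IsBSCC (G.chain σ γ) U) (hk : IsLeast (p '' U) k) (hαk : 0 < α k)
    (f : V → ℝ)
    (hfk : ∀ v ∈ U, p v = k → f v = (1 - α k) * ∑ w, (G.chain σ γ v w).toReal * f w)
    (hf : ∀ v ∈ U, k < p v → f v ≤ α (k + 1) + ∑ w, (G.chain σ γ v w).toReal * f w) :
    ∀ v ∈ U, f v ≤
      α (k + 1) / α k * (2 * (G.deltaMin⁻¹ ^ (Fintype.card V - 1) - 1)) := by
  have hαk' : (0 : ℝ) < α k := hαk
  obtain ⟨x, hx, hmax⟩ := Set.exists_max_image U f (Set.toFinite U) hU.1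
  have hclosed : ∀ v ∈ U, ∀ w, 0 < (G.chain σ γ v w).toReal → w ∈ U := by
    intro v hv w hw
    by_contra h
    simp [hU.2.2 v hv w h] at hw
  have hle : ∀ v ∈ U, ∑ w, (G.chain σ γ v w).toReal * f w ≤ f x := by
    intro v hv
    calc ∑ w, (G.chain σ γ v w).toReal * f w ≤ ∑ w, (G.chain σ γ v w).toReal * f x := by
          refine Finset.sum_le_sum fun w _ => ?_
          rcases (ENNReal.toReal_nonneg (a := G.chain σ γ v w)).eq_or_lt with h0 | h0
          · simp [← h0]
          · exact mul_le_mul_of_nonneg_left (hmax w (hclosed v hv w h0)) h0.le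
      _ = f x := by rw [← Finset.sum_mul, sum_toReal_chain, one_mul]
  -- The bound `m` on `T` is `(1 - α k)` times the maximum `f x` itself. Evaluating the conclusion
  -- at `x` and cancelling leaves `α k * f x ≤ α (k + 1) * C`.
  have hpot := le_of_subharmonic_up_to (fun v w => (G.chain σ γ v w).toReal)
    (fun _ _ => ENNReal.toReal_nonneg) (sum_toReal_chain G σ γ) hδ hδ2
    (fun v w h => G.deltaMin_le_chain σ γ (by linarith) h)
    (S := U) (T := {v | p v = k}) hclosed ?_ f (b := α (k + 1)) (m := (1 - α k) * f x)
    (α (k + 1)).2.1 ?_ ?_ x hx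
  · intro v hv
    refine (hmax v hv).trans ?_
    rw [div_mul_eq_mul_div, le_div_iff₀ hαk']
    linarith
  · intro v hv
    obtain ⟨u, hu, hpu⟩ := hk.1
    exact ⟨u, hpu, Relation.ReflTransGen.mono (fun _ _ h => (toReal_chain_pos G σ γ).2 h) _ _
      (hU.2.1.prop v hv u hu).to_reflTransGen⟩
  · intro v hv hpv
    rw [hfk v hv hpv]
    exact mul_le_mul_of_nonneg_left (hle v hv) (by linarith [(α k).2.2])
  · intro v hv hpv
    exact hf v hv (lt_of_le_of_ne (hk.2 ⟨v, hv, rfl⟩) (Ne.symm hpv))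

/-- A `bar` value is an average of `hat` values within `U`, because no transition leaves `U`. -/
lemma forall_mem_tildeSet_le [Fintype V] {U : Set V} (hU : IsBSCC (G.chain σ γ) U)
    {g : GVertex V → ℝ} {c : ℝ} (hg : ∀ v, g (bar v) = ∑ w, (G.chain σ γ v w).toReal * g (hat w))
    (hc : ∀ v ∈ U, g (hat v) ≤ c) : ∀ x ∈ tildeSet U, g x ≤ c := by
  rintro _ (⟨v, hv, rfl⟩ | ⟨v, hv, rfl⟩)
  · rw [hg]
    calc ∑ w, (G.chain σ γ v w).toReal * g (hat w) ≤ ∑ w, (G.chain σ γ v w).toReal * c := by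
          refine Finset.sum_le_sum fun w _ => ?_
          by_cases hw : w ∈ U
          · exact mul_le_mul_of_nonneg_left (hc w hw) ENNReal.toReal_nonneg
          · simp [hU.2.2 v hv w hw]
      _ = c := by rw [← Finset.sum_mul, sum_toReal_chain, one_mul]
  · exact hc v hv

lemma reachProb_win_ge_of_even [Fintype V] (hα : Antitone α) (hδ : 0 < G.deltaMin)
    (hδ2 : G.deltaMin ≤ 1 / 2) {U : Set V} {k : ℕ} (hU : IsBSCC (G.chain σ γ) U)
    (hk : IsLeast (p '' U) k) (hαk : 0 < α k) (heven : Even k) :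
    ∀ x ∈ tildeSet U, 1 - reachProb (gadgetChain G p α σ γ) x {win} ≤
      α (k + 1) / α k * (2 * (G.deltaMin⁻¹ ^ (Fintype.card V - 1) - 1)) := by
  set r := fun x => reachProb (gadgetChain G p α σ γ) x {win} with hr
  have hbar : ∀ v, 1 - r (bar v) = ∑ w, (G.chain σ γ v w).toReal * (1 - r (hat w)) := by
    intro v
    simp only [mul_sub, Finset.sum_sub_distrib, mul_one, sum_toReal_chain]
    rw [hr]
    simp only
    rw [reachProb_bar G p α σ γ (v := v) (by simp)]
  have hwin : r win = 1 := reachProb_of_mem _ rfl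
  have hhat : ∀ v, r (hat v) = α (p v) * r (if Even (p v) then win else lose) +
      (1 - α (p v)) * r (bar v) := fun v => reachProb_hat G p α σ γ (by simp)
  refine forall_mem_tildeSet_le G σ γ hU (g := fun x => 1 - r x) hbar ?_
  -- Here `f v = 1 - r (hat v)`: at priority `k` the exit goes to `win`, where the loss is 0, and
  -- elsewhere the exit probability is at most `α (k + 1)`.
  refine le_of_isBSCC G p α σ γ hδ hδ2 hU hk hαk _ ?_ ?_
  · intro v hv hpv
    rw [← hbar, hhat, hpv, if_pos heven, hwin]
    ring
  · intro v hv hpv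
    have h1 : (α (p v) : ℝ) ≤ α (k + 1) := hα hpv
    have h2 := (α (p v)).2.1
    have h3 : 0 ≤ r (bar v) := reachProb_nonneg _ _ _
    have h4 : r (bar v) ≤ 1 := reachProb_le_one _ _ _
    have h5 : 0 ≤ r (if Even (p v) then win else lose) := reachProb_nonneg _ _ _
    rw [← hbar, hhat]
    nlinarith [mul_nonneg h2 h5, mul_le_mul_of_nonneg_left h4 h2]

lemma reachProb_win_le_of_odd [Fintype V] (hα : Antitone α) (hδ : 0 < G.deltaMin)
    (hδ2 : G.deltaMin ≤ 1 / 2) {U : Set V} {k : ℕ} (hU : IsBSCC (G.chain σ γ) U)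
    (hk : IsLeast (p '' U) k) (hαk : 0 < α k) (hodd : Odd k) :
    ∀ x ∈ tildeSet U, reachProb (gadgetChain G p α σ γ) x {win} ≤
      α (k + 1) / α k * (2 * (G.deltaMin⁻¹ ^ (Fintype.card V - 1) - 1)) := by
  set r := fun x => reachProb (gadgetChain G p α σ γ) x {win}
  have hbar : ∀ v, r (bar v) = ∑ w, (G.chain σ γ v w).toReal * r (hat w) :=
    fun v => reachProb_bar G p α σ γ (by simp)
  have hlose : r lose = 0 := reachProb_absorbing _ (by simp) (gadgetChain_lose G p α σ γ)
  have hhat : ∀ v, r (hat v) = α (p v) * r (if Even (p v) then win else lose) +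
      (1 - α (p v)) * r (bar v) := fun v => reachProb_hat G p α σ γ (by simp)
  refine forall_mem_tildeSet_le G σ γ hU (g := r) hbar ?_
  refine le_of_isBSCC G p α σ γ hδ hδ2 hU hk hαk _ ?_ ?_
  · intro v hv hpv
    rw [← hbar, hhat, hpv, if_neg (Nat.not_even_iff_odd.2 hodd), hlose]
    ring
  · intro v hv hpv
    have h1 : (α (p v) : ℝ) ≤ α (k + 1) := hα hpv
    have h2 := (α (p v)).2.1
    have h3 : 0 ≤ r (bar v) := reachProb_nonneg _ _ _
    have h5 : r (if Even (p v) then win else lose) ≤ 1 := reachProb_le_one _ _ _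
    rw [← hbar, hhat]
    nlinarith [mul_nonneg h2 h3, mul_le_mul_of_nonneg_left h5 h2]

end gadget

/-- The loss inside a component in terms of `D = 1 / ε`. -/
lemma ratio_mul_le {δ D C q : ℝ} {n : ℕ} (hδ : 0 < δ) (hδ2 : δ ≤ 1 / 2) (hD : 0 < D) (hC : 0 ≤ C)
    (hq : q ≤ δ ^ n * (1 - δ) / (8 * D + 1)) (hlt : δ ^ n * C < 2 * δ) :
    q * C ≤ 1 - 4 / (4 + 1 / D) := by
  have h1 : 1 - 4 / (4 + 1 / D) = 1 / (4 * D + 1) := by field_simp; ring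
  rw [h1]
  refine (mul_le_mul_of_nonneg_right hq hC).trans ?_
  rw [div_mul_eq_mul_div, div_le_div_iff₀ (by positivity) (by positivity)]
  -- The left side is at most `2 * δ * (1 - δ)`, and `δ ≤ 1 / 2`.
  have h2 : δ ^ n * (1 - δ) * C ≤ 1 := by
    nlinarith [mul_le_mul_of_nonneg_right hlt.le (show 0 ≤ 1 - δ by linarith)]
  nlinarith

end StochasticGame

open StochasticGame in
theorem mainTheorem3 {V : Type*} [Fintype V] (G : Arena V) (p : V → ℕ) (α : ℕ → unitInterval)
    (hα : Antitone α)
    (hδ : 0 < G.deltaMin ∧ G.deltaMin ≤ 1 / 2)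
    (num den : {v : V // G.owner v = Owner.random} → V → ℕ)
    (hrat : ∀ u v, 0 < den u v ∧ num u v ≤ den u v ∧
      (G.Δ u v).toReal = (num u v : ℝ) / (den u v : ℝ))
    (n : ℕ) (hn : n = Fintype.card V) (M : ℕ) (hM : M = G.maxDen den) :
    ((α 0 : ℝ) ≤ G.deltaMin ^ n / (8 * ((n.factorial : ℝ) ^ 2 * (M : ℝ) ^ (2 * n ^ 2))) →
      ∀ (σ : G.Strategy Owner.eve) (γ : G.Strategy Owner.adam) (v : V),
        crossPath G p α σ γ v > (4 - epsilon n M) / 4) ∧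
    ((∀ k, 0 < α k) →
      (∀ k, (α (k + 1) : ℝ) / (α k : ℝ) ≤ G.deltaMin ^ n * (1 - G.deltaMin) /
        (8 * ((n.factorial : ℝ) ^ 2 * (M : ℝ) ^ (2 * n ^ 2)) + 1)) →
      ∀ (σ : G.Strategy Owner.eve) (γ : G.Strategy Owner.adam) (U : Set V) (k : ℕ),
        IsBSCC (G.chain σ γ) U → IsLeast (p '' U) k →
          (Even k → winEven G p α σ γ U ≥ 4 / (4 + epsilon n M)) ∧
          (Odd k → winOdd G p α σ γ U ≤ 1 - 4 / (4 + epsilon n M))) := by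
  obtain ⟨hδ0, hδ2⟩ := hδ
  have hM1 : 1 ≤ M := hM ▸ G.one_le_maxDen hδ0 den fun u v => (hrat u v).1
  set D : ℝ := (n.factorial : ℝ) ^ 2 * (M : ℝ) ^ (2 * n ^ 2)
  have hM0 : (0 : ℝ) < M := by exact_mod_cast hM1
  have hD0 : 0 < D := by positivity
  have hε : epsilon n M = 1 / D := rfl
  have hC : 0 ≤ 2 * (G.deltaMin⁻¹ ^ (n - 1) - 1) := by
    have := one_le_pow₀ ((one_le_inv₀ hδ0).2 (by linarith)) (n := n - 1)
    linarith
  refine ⟨fun h0 σ γ v => ?_, fun hpos hratio σ γ U k hU hk => ?_⟩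
  · have hn1 : 1 ≤ n := hn ▸ Fintype.card_pos_iff.2 ⟨v⟩
    have h := one_sub_crossPath_le G p α σ γ hα hδ0 hδ2 v
    rw [← hn] at h
    have h1 := pow_mul_two_mul_inv_pow_sub_one_lt hδ0 hn1
    -- The product is below `2 * δ / (8 * D) = δ / (4 * D)`, which is less than `ε / 4`.
    have h2 : (α 0 : ℝ) * (2 * (G.deltaMin⁻¹ ^ (n - 1) - 1)) < 1 / D / 4 := by
      refine (mul_le_mul_of_nonneg_right h0 hC).trans_lt ?_
      rw [div_mul_eq_mul_div, div_div, div_lt_div_iff₀ (by positivity) (by positivity)]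
      nlinarith
    rw [hε]
    linarith
  · have hn1 : 1 ≤ n := hn ▸ Fintype.card_pos_iff.2 ⟨hU.1.some⟩
    have h1 := ratio_mul_le hδ0 hδ2 hD0 hC (hratio k)
      (pow_mul_two_mul_inv_pow_sub_one_lt hδ0 hn1)
    have hne : (tildeSet U).Nonempty := ⟨_, Or.inl ⟨_, hU.1.some_mem, rfl⟩⟩
    rw [hε]
    constructor
    · intro heven
      refine le_csInf (hne.image _) ?_
      rintro _ ⟨x, hx, rfl⟩
      have h := reachProb_win_ge_of_even G p α σ γ hα hδ0 hδ2 hU hk (hpos k) heven x hx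
      rw [← hn] at h
      simp only
      linarith
    · intro hodd
      refine csSup_le (hne.image _) ?_
      rintro _ ⟨x, hx, rfl⟩
      have h := reachProb_win_le_of_odd G p α σ γ hα hδ0 hδ2 hU hk (hpos k) hodd x hx
      rw [← hn] at h
      exact h.trans h1
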